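/- A digraph here is finite and simple (no loops, no multiple arcs); its spectral radius $\rho(D)$ is the largest modulus of an eigenvalue of its adjacency matrix. For $a,b,c\ge 0$ with $a,b$ not both $0$, let $\theta(a,b,c)$ be the digraph on $a+b+c+2$ vertices formed by two distinct vertices $u$ and $w$, two directed paths from $u$ to $w$ with $a$ and with $b$ internal vertices, and a directed path from $w$ to $u$ with $c$ internal vertices, the three paths having no internal vertices in common. Say that a strongly connected digraph $D$ on $n$ vertices achieves the $k$-th smallest spectral radius if exactly $k-1$ distinct real numbers smaller than $\rho(D)$ are spectral radii of strongly connected digraphs on $n$ vertices. **Theorem.** Let $n\ge 4$. Then, up to isomorphism, $\theta(0,1,n-3)$, $\theta(1,1,n-4)$ and $\theta(0,2,n-4)$ are the unique digraphs that achieve the second, the third and the fourth smallest spectral radius, respectively, among all strongly connected digraphs on $n$ vertices. -/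

import Mathlib

/-- A digraph is simple if it has no loops (a `Digraph` has no multiple arcs), and strongly connected
if every vertex is joined to every vertex by a directed path. -/
structure IsSimpleStrong {V : Type*} (D : Digraph V) : Prop where
  loopless : ∀ v, ¬ D.Adj v v
  strong : ∀ u v, Relation.ReflTransGen D.Adj u v

open Classical in
/-- The adjacency matrix of a digraph, over `ℂ`. -/
noncomputable def adjMat {V : Type*} (D : Digraph V) : Matrix V V ℂ :=
  Matrix.of fun i j => if D.Adj i j then 1 else 0

open Classical in
/-- The spectral radius of a finite digraph: the largest modulus of a complex eigenvalue of its
adjacency matrix (the spectrum of a matrix is finite, so `toReal` loses nothing). -/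
noncomputable def specRad {V : Type*} [Fintype V] (D : Digraph V) : ℝ :=
  (spectralRadius ℂ (adjMat D)).toReal

/-- The simple strongly connected digraph `D` achieves the `k`-th smallest spectral radius among all
simple strongly connected digraphs on its vertex set: exactly `k - 1` different real numbers smaller
than its spectral radius are spectral radii of such digraphs. -/
def AchievesKthSmallest {V : Type*} [Fintype V] (k : ℕ) (D : Digraph V) : Prop :=
  IsSimpleStrong D ∧
    {r : ℝ | r < specRad D ∧ ∃ D' : Digraph V, IsSimpleStrong D' ∧ specRad D' = r}.encard + 1 = k

/-- `x → y` is an arc of the directed path from `s` to `t` with the internal vertices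
`f 0, f 1, …, f (m - 1)`, in this order. -/
def PathArc {W : Type*} {m : ℕ} (s : W) (f : Fin m → W) (t : W) (x y : W) : Prop :=
  ∃ i : Fin (m + 1),
    x = (Fin.cons s (Fin.snoc f t : Fin (m + 1) → W) : Fin (m + 2) → W) i.castSucc ∧
    y = (Fin.cons s (Fin.snoc f t : Fin (m + 1) → W) : Fin (m + 2) → W) i.succ

/-- The vertices of `θ(a, b, c)`: two branch vertices, and the internal vertices of the
three paths. -/
inductive ThetaVertex (a b c : ℕ) : Type
  | source : ThetaVertex a b c
  | target : ThetaVertex a b c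
  | inA : Fin a → ThetaVertex a b c
  | inB : Fin b → ThetaVertex a b c
  | inC : Fin c → ThetaVertex a b c

/-- The digraph `θ(a, b, c)`: directed paths with `a` and with `b` internal vertices from `source`
to `target`, and a directed path with `c` internal vertices from `target` back to `source`. -/
def thetaDigraph (a b c : ℕ) : Digraph (ThetaVertex a b c) where
  Adj x y :=
    PathArc .source .inA .target x y ∨ PathArc .source .inB .target x y ∨
      PathArc .target .inC .source x y

/-!
The proof compares a strongly connected digraph `D` with positive test vectors. If `y > 0` and the
sum of `y` over the out-neighbours of every vertex `x` is at least `L * y x`, then `L ≤ ρ(D)`, and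
the inequality is strict as soon as it is strict at one vertex (`le_specRad`, from Gelfand's
formula, and `lt_specRad`); if all these sums equal `L * y x`, then `ρ(D) = L` (`specRad_eq`).

With `t = 1 / L`, the spectral radii `L` of `θ(0, 1, n - 3)`, `θ(1, 1, n - 4)` and
`θ(0, 2, n - 4)` are given by `t ^ n + t ^ (n - 1) = 1`, `2 * t ^ (n - 1) = 1` and
`t ^ n + t ^ (n - 2) = 1`; they increase strictly in this order.

If every vertex of `D` has a single out-neighbour, then `ρ(D) = 1`. Otherwise let `u` have distinct
out-neighbours `v₁` and `v₂`, and let `h` be the distance to `u`. The test vector `t ^ h` satisfies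
the inequality at all vertices `x ≠ u`, because some out-neighbour of `x` is closer to `u`; at `u`
it holds strictly if `t ^ (h v₁ + 1) + t ^ (h v₂ + 1) > 1`. So two closed walks through `u` of
lengths `h v₁ + 1` and `h v₂ + 1` which leave `u` differently already bound `ρ(D)` from below, and
no disjointness of paths is needed. With the `t` of `θ(0, 2, n - 4)` this gives a strict inequality
unless `{h v₁, h v₂}` is one of `{n - 1, n - 2}`, `{n - 2}` and `{n - 1, n - 3}`. All values up to
the maximum of `h` occur, so in these cases the `n` vertices are determined by their distances, up
to exchanging `v₁` and `v₂`, and `D` contains one of the three extremal digraphs. An arc beyond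
these leads to a larger spectral radius: for `θ(0, 2, n - 4)` by strict monotonicity
(`lt_specRad_of_lt`), in the other cases because two shorter closed walks arise, at `u` or at
another root (`IsPotential.rotate`, `IsPotential.lt_specRad_of_le`) or because the two twins of
`θ(1, 1, n - 4)` are joined by an arc (`IsPotential.lt_specRad_of_adj`). This is
`specRad_classification`; the ranking of the values is then a matter of counting.
-/

open Finset Filter Topology

/-! ### The successor operator and the spectral radius -/

open Classical in
/-- The adjacency operator of `D` on real functions: sum over the out-neighbours. -/
noncomputable def succSum {V : Type*} [Fintype V] (D : Digraph V) : (V → ℝ) →ₗ[ℝ] (V → ℝ) where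
  toFun y x := ∑ z with D.Adj x z, y z
  map_add' y y' := by ext x; simp [Finset.sum_add_distrib]
  map_smul' c y := by ext x; simp [Finset.mul_sum]

section Spectral

variable {V : Type*} [Fintype V] {D : Digraph V}

open Classical in
theorem succSum_apply (y : V → ℝ) (x : V) : succSum D y x = ∑ z with D.Adj x z, y z := rfl

theorem succSum_mono {y y' : V → ℝ} (h : y ≤ y') : succSum D y ≤ succSum D y' := by
  classical
  intro x
  simp only [succSum_apply]
  exact Finset.sum_le_sum fun z _ => h z

theorem succSum_nonneg {y : V → ℝ} (h : 0 ≤ y) : 0 ≤ succSum D y := by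
  simpa using succSum_mono (D := D) h

theorem le_succSum {y : V → ℝ} (h : 0 ≤ y) {x z : V} (hz : D.Adj x z) :
    y z ≤ succSum D y x := by
  classical
  rw [succSum_apply]
  exact Finset.single_le_sum (f := y) (fun z _ => h z) (by simpa using hz)

theorem add_le_succSum {y : V → ℝ} (h : 0 ≤ y) {x z z' : V} (hz : D.Adj x z)
    (hz' : D.Adj x z') (hne : z ≠ z') : y z + y z' ≤ succSum D y x := by
  classical
  rw [succSum_apply, ← Finset.sum_pair hne]
  refine Finset.sum_le_sum_of_subset_of_nonneg ?_ fun i _ _ => h i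
  intro a ha
  simp only [Finset.mem_insert, Finset.mem_singleton] at ha
  rcases ha with rfl | rfl <;> simpa

open Classical in
theorem adjMat_mulVec_apply (v : V → ℂ) (x : V) :
    (adjMat D).mulVec v x = ∑ z with D.Adj x z, v z := by
  simp [Matrix.mulVec, dotProduct, adjMat, Finset.sum_filter]

open Classical in
theorem adjMat_pow_mulVec_ofReal (y : V → ℝ) (k : ℕ) :
    ((adjMat D) ^ k).mulVec (fun x => (y x : ℂ)) = fun x => (((succSum D ^ k) y x : ℝ) : ℂ) := by
  induction k with
  | zero => simp
  | succ k ih =>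
    rw [pow_succ', ← Matrix.mulVec_mulVec, ih, pow_succ', Module.End.mul_apply]
    ext x
    rw [adjMat_mulVec_apply, succSum_apply]
    push_cast
    rfl

open Classical in
theorem spectralRadius_le_of_succSum_le {y : V → ℝ} (hy : ∀ x, 0 < y x) {L : ℝ}
    (h : succSum D y ≤ L • y) : spectralRadius ℂ (adjMat D) ≤ ENNReal.ofReal L := by
  refine iSup₂_le fun μ hμ => ?_
  rw [spectrum.mem_iff, Matrix.isUnit_iff_isUnit_det, isUnit_iff_ne_zero, not_not,
    ← Matrix.exists_mulVec_eq_zero_iff] at hμ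
  obtain ⟨v, hv0, hv⟩ := hμ
  rw [Matrix.sub_mulVec, Algebra.algebraMap_eq_smul_one, Matrix.smul_mulVec, Matrix.one_mulVec,
    sub_eq_zero] at hv
  obtain ⟨x₁, hx₁⟩ := Function.ne_iff.mp hv0
  -- Compare `v` with `y` at a vertex where the ratio `‖v‖ / y` is largest.
  obtain ⟨x, -, hx⟩ := Finset.exists_max_image univ (fun x => ‖v x‖ / y x) ⟨x₁, mem_univ _⟩
  set M := ‖v x‖ / y x with hM
  have hMpos : 0 < M :=
    (div_pos (norm_pos_iff.mpr hx₁) (hy x₁)).trans_le (hx x₁ (mem_univ _))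
  have hbound : ∀ z, ‖v z‖ ≤ M * y z := fun z => (div_le_iff₀ (hy z)).mp (hx z (mem_univ _))
  have hvx : ‖v x‖ = M * y x := by rw [hM, div_mul_cancel₀ _ (hy x).ne']
  have key : ‖μ‖ * (M * y x) ≤ L * (M * y x) := by
    calc ‖μ‖ * (M * y x) = ‖(adjMat D).mulVec v x‖ := by
          rw [← hv, ← hvx, Pi.smul_apply, norm_smul]
      _ ≤ ∑ z with D.Adj x z, M * y z := by
          rw [adjMat_mulVec_apply]
          exact norm_sum_le_of_le _ fun z _ => hbound z
      _ = M * succSum D y x := by rw [succSum_apply, Finset.mul_sum]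
      _ ≤ M * (L * y x) := by gcongr; exact h x
      _ = L * (M * y x) := by ring
  have hle : ‖μ‖ ≤ L := le_of_mul_le_mul_right key (mul_pos hMpos (hy x))
  simpa [← ofReal_norm', enorm_eq_nnnorm] using ENNReal.ofReal_le_ofReal hle

open Classical in
theorem spectralRadius_ne_top : spectralRadius ℂ (adjMat D) ≠ ⊤ := by
  refine ne_top_of_le_ne_top ENNReal.ofReal_ne_top
    (spectralRadius_le_of_succSum_le (y := fun _ => 1) (L := Fintype.card V) (by simp) ?_)
  intro x
  simp only [succSum_apply, Finset.sum_const, nsmul_eq_mul, mul_one, Pi.smul_apply, smul_eq_mul]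
  exact_mod_cast Finset.card_le_univ _

/-- Collatz–Wielandt upper bound: a positive supersolution bounds the spectral radius. -/
theorem specRad_le {y : V → ℝ} (hy : ∀ x, 0 < y x) {L : ℝ} (hL : 0 ≤ L)
    (h : succSum D y ≤ L • y) : specRad D ≤ L :=
  ENNReal.toReal_le_of_le_ofReal hL (spectralRadius_le_of_succSum_le hy h)

theorem pow_smul_le_succSum_pow {y : V → ℝ} {L : ℝ} (hL : 0 ≤ L) (h : L • y ≤ succSum D y)
    (k : ℕ) : L ^ k • y ≤ (succSum D ^ k) y := by
  induction k with
  | zero => simp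
  | succ k ih =>
    calc L ^ (k + 1) • y = L ^ k • (L • y) := by rw [pow_succ, mul_smul]
      _ ≤ L ^ k • succSum D y := smul_le_smul_of_nonneg_left h (by positivity)
      _ = succSum D (L ^ k • y) := by rw [map_smul]
      _ ≤ succSum D ((succSum D ^ k) y) := succSum_mono ih
      _ = (succSum D ^ (k + 1)) y := by rw [pow_succ', Module.End.mul_apply]

attribute [local instance] Matrix.linftyOpNormedRing Matrix.linftyOpNormedAlgebra

/-- Collatz–Wielandt lower bound, from Gelfand's formula: a positive subsolution bounds the
spectral radius from below. -/
theorem le_specRad [Nonempty V] {y : V → ℝ} (hy : ∀ x, 0 < y x) {L : ℝ} (hL : 0 ≤ L)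
    (h : L • y ≤ succSum D y) : L ≤ specRad D := by
  classical
  obtain ⟨x⟩ := ‹Nonempty V›
  set w : V → ℂ := fun x => (y x : ℂ) with hw
  have hwx : ‖w x‖ = y x := by simp [hw, abs_of_pos (hy x)]
  have hwpos : 0 < ‖w‖ := (hwx ▸ hy x).trans_le (norm_le_pi_norm w x)
  set c := y x / ‖w‖ with hc
  have hcpos : 0 < c := div_pos (hy x) hwpos
  have hnorm : ∀ k : ℕ, L ^ k * c ≤ ‖adjMat D ^ k‖ := by
    intro k
    have h1 := pow_smul_le_succSum_pow hL h k x
    have h2 := (norm_le_pi_norm ((adjMat D ^ k).mulVec w) x).trans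
      (Matrix.linfty_opNorm_mulVec (adjMat D ^ k) w)
    rw [hw, adjMat_pow_mulVec_ofReal, Complex.norm_real] at h2
    rw [hc, ← mul_div_assoc, div_le_iff₀ hwpos]
    exact (h1.trans (le_abs_self _)).trans h2
  have hlim := spectrum.pow_norm_pow_one_div_tendsto_nhds_spectralRadius (adjMat D)
  have hroot : Tendsto (fun k : ℕ => L * c ^ (1 / (k : ℝ))) atTop (𝓝 L) := by
    have := (Real.continuous_const_rpow hcpos.ne').tendsto 0 |>.comp
      (tendsto_one_div_atTop_nhds_zero_nat (𝕜 := ℝ))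
    simpa using this.const_mul L
  have hle : ENNReal.ofReal L ≤ spectralRadius ℂ (adjMat D) := by
    refine le_of_tendsto_of_tendsto (ENNReal.tendsto_ofReal hroot) hlim ?_
    filter_upwards [eventually_gt_atTop 0] with k hk
    refine ENNReal.ofReal_le_ofReal ?_
    have hk' : (k : ℝ) ≠ 0 := by exact_mod_cast hk.ne'
    calc L * c ^ (1 / (k : ℝ)) = (L ^ k * c) ^ (1 / (k : ℝ)) := by
          rw [Real.mul_rpow (by positivity) hcpos.le, ← Real.rpow_natCast L k, ← Real.rpow_mul hL,
            mul_one_div_cancel hk', Real.rpow_one]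
      _ ≤ ‖adjMat D ^ k‖ ^ (1 / (k : ℝ)) :=
          Real.rpow_le_rpow (by positivity) (hnorm k) (by positivity)
  exact (ENNReal.ofReal_le_iff_le_toReal spectralRadius_ne_top).mp hle

theorem specRad_eq [Nonempty V] {y : V → ℝ} (hy : ∀ x, 0 < y x) {L : ℝ} (hL : 0 ≤ L)
    (h : succSum D y = L • y) : specRad D = L :=
  le_antisymm (specRad_le hy hL h.le) (le_specRad hy hL h.ge)

theorem one_add_succSum_pow_nonneg {u : V → ℝ} (hu : 0 ≤ u) (k : ℕ) :
    0 ≤ ((1 + succSum D : Module.End ℝ (V → ℝ)) ^ k) u := by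
  induction k with
  | zero => simpa
  | succ k ih =>
    rw [pow_succ', Module.End.mul_apply]
    exact add_nonneg ih (succSum_nonneg ih)

theorem one_add_succSum_pow_mono {u : V → ℝ} (hu : 0 ≤ u) :
    Monotone fun k : ℕ => ((1 + succSum D : Module.End ℝ (V → ℝ)) ^ k) u := by
  refine monotone_nat_of_le_succ fun k => ?_
  rw [pow_succ', Module.End.mul_apply]
  exact le_add_of_nonneg_right (succSum_nonneg (one_add_succSum_pow_nonneg hu k))

theorem exists_pow_pos {u : V → ℝ} (hu : 0 ≤ u) {x₀ : V} (h₀ : 0 < u x₀) {x : V}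
    (hx : Relation.ReflTransGen D.Adj x x₀) :
    ∃ k, 0 < (((1 + succSum D : Module.End ℝ (V → ℝ)) ^ k) u) x := by
  induction hx using Relation.ReflTransGen.head_induction_on with
  | refl => exact ⟨0, by simpa⟩
  | head hab _ ih =>
    obtain ⟨k, hk⟩ := ih
    refine ⟨k + 1, ?_⟩
    rw [pow_succ', Module.End.mul_apply]
    exact add_pos_of_nonneg_of_pos (one_add_succSum_pow_nonneg hu k _)
      (hk.trans_le (le_succSum (one_add_succSum_pow_nonneg hu k) hab))

/-- A positive subsolution that is strict at one vertex of a strongly connected digraph bounds the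
spectral radius strictly: applying a power of `1 + succSum D` to it spreads the excess to every
vertex. -/
theorem lt_specRad (hD : IsSimpleStrong D) {y : V → ℝ} (hy : ∀ x, 0 < y x) {L : ℝ} (hL : 0 ≤ L)
    (h : L • y ≤ succSum D y) {x₀ : V} (h₀ : L * y x₀ < succSum D y x₀) : L < specRad D := by
  set B : Module.End ℝ (V → ℝ) := 1 + succSum D with hB
  set u := succSum D y - L • y with hu
  have hu0 : 0 ≤ u := sub_nonneg.mpr h
  have hux : 0 < u x₀ := sub_pos.mpr h₀
  choose k hk using fun x => exists_pow_pos hu0 hux (hD.strong x x₀)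
  set N := univ.sup k
  have hN : ∀ x, 0 < (B ^ N) u x := fun x =>
    (hk x).trans_le (one_add_succSum_pow_mono hu0 (Finset.le_sup (f := k) (mem_univ x)) x)
  have hw : ∀ x, 0 < (B ^ N) y x := fun x =>
    (hy x).trans_le (one_add_succSum_pow_mono (fun x => (hy x).le) (Nat.zero_le N) x)
  have hcomm : Commute (succSum D : Module.End ℝ (V → ℝ)) (B ^ N) :=
    ((Commute.one_right _).add_right (Commute.refl _)).pow_right N
  have hexc : ∀ x, succSum D ((B ^ N) y) x = L * (B ^ N) y x + (B ^ N) u x := by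
    intro x
    have h1 : succSum D ((B ^ N) y) = (B ^ N) (succSum D y) := LinearMap.congr_fun hcomm y
    have h2 : (B ^ N) u = (B ^ N) (succSum D y) - L • (B ^ N) y := by rw [hu, map_sub, map_smul]
    rw [h1, h2]
    simp
  have : Nonempty V := ⟨x₀⟩
  obtain ⟨x, -, hx⟩ := Finset.exists_min_image univ (fun x => (B ^ N) u x / (B ^ N) y x)
    ⟨x₀, mem_univ _⟩
  set ε := (B ^ N) u x / (B ^ N) y x
  have hε : 0 < ε := div_pos (hN x) (hw x)
  refine (lt_add_of_pos_right L hε).trans_le (le_specRad hw (by positivity) fun z => ?_)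
  have := (le_div_iff₀ (hw z)).mp (hx z (mem_univ z))
  rw [hexc]
  simp only [Pi.smul_apply, smul_eq_mul]
  linarith

/-- Adding arcs to a digraph with a positive eigenvector, so as to obtain a strongly connected
digraph, increases the spectral radius. -/
theorem lt_specRad_of_lt (hD : IsSimpleStrong D) {R : V → V → Prop} (hR : ∀ x z, R x z → D.Adj x z)
    {y : V → ℝ} (hy : ∀ x, 0 < y x) {L : ℝ} (hL : 0 ≤ L)
    (h : succSum ⟨R⟩ y = L • y) {x₀ z₀ : V} (h₀ : D.Adj x₀ z₀) (h₀' : ¬ R x₀ z₀) :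
    L < specRad D := by
  classical
  have hsub : ∀ x, (univ.filter fun z => R x z) ⊆ univ.filter fun z => D.Adj x z := by
    intro x z
    simpa using hR x z
  refine lt_specRad hD hy hL (x₀ := x₀) (h ▸ fun x => ?_) ?_
  · simp only [succSum_apply]
    exact Finset.sum_le_sum_of_subset_of_nonneg (hsub x) fun i _ _ => (hy i).le
  · rw [← smul_eq_mul, ← Pi.smul_apply, ← h]
    simp only [succSum_apply]
    exact Finset.sum_lt_sum_of_subset (hsub x₀) (i := z₀) (by simpa) (by simpa) (hy _)
      fun i _ _ => (hy i).le

end Spectral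

/-! ### Labelled models of the extremal digraphs -/

/-- The Hamiltonian cycle `n - 1 → n - 2 → ⋯ → 0 → n - 1` on the labels below `n`, together with the
chord `0 → j`. For `j = n - 1` this is the cycle alone; for `j = n - 2` and `j = n - 3` it is
`θ(0, 1, n - 3)` and `θ(0, 2, n - 4)`. -/
def ChordArc (n j p q : ℕ) : Prop :=
  p = q + 1 ∨ p = 0 ∧ (q = n - 1 ∨ q = j)

/-- The cycle `n - 2 → ⋯ → 0 → n - 2` together with a twin `n - 1` of its vertex `n - 2`; this is
`θ(1, 1, n - 4)`. -/
def TwinArc (n p q : ℕ) : Prop :=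
  p = q + 1 ∧ p ≤ n - 2 ∨ p = n - 1 ∧ q = n - 3 ∨ p = 0 ∧ (q = n - 2 ∨ q = n - 1)

/-- The vertices of `D` can be labelled bijectively by the numbers below `n` so that the arcs are
given by the relation `R` on labels. -/
def LabelledBy {V : Type*} (D : Digraph V) (n : ℕ) (R : ℕ → ℕ → Prop) : Prop :=
  ∃ f : V ≃ Fin n, ∀ x y, D.Adj x y ↔ R (f x) (f y)

theorem LabelledBy.nonempty_relIso_iff {V W : Type*} {D : Digraph V} {D' : Digraph W} {n : ℕ}
    {R : ℕ → ℕ → Prop} (h' : LabelledBy D' n R) :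
    Nonempty (D.Adj ≃r D'.Adj) ↔ LabelledBy D n R := by
  obtain ⟨f', hf'⟩ := h'
  constructor
  · rintro ⟨e⟩
    refine ⟨e.toEquiv.trans f', fun x y => ?_⟩
    rw [← e.map_rel_iff, hf']
    rfl
  · rintro ⟨f, hf⟩
    exact ⟨⟨f.trans f'.symm, by simp [hf, hf']⟩⟩

theorem labelledBy_of_injective {V : Type*} {D : Digraph V} {n : ℕ} {R : ℕ → ℕ → Prop}
    (f : V → ℕ) (hlt : ∀ x, f x < n) (hinj : Function.Injective f)
    (hsurj : ∀ p < n, ∃ x, f x = p) (hR : ∀ x y, D.Adj x y ↔ R (f x) (f y)) :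
    LabelledBy D n R := by
  refine ⟨Equiv.ofBijective (fun x => ⟨f x, hlt x⟩) ⟨fun x y hxy => hinj ?_, fun p => ?_⟩,
    fun x y => hR x y⟩
  · simpa using hxy
  · obtain ⟨x, hx⟩ := hsurj p p.2
    exact ⟨x, Fin.ext hx⟩

/-- The last hypothesis says that every nonzero label is entered from `0` or from a larger label,
so that all labels are reached from `0`. -/
theorem LabelledBy.isSimpleStrong {V : Type*} {D : Digraph V} {n : ℕ} {R : ℕ → ℕ → Prop}
    (h : LabelledBy D n R) (hirr : ∀ p, ¬ R p p)
    (hout : ∀ p < n, 0 < p → ∃ q < p, R p q)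
    (hin : ∀ q < n, 0 < q → ∃ p < n, R p q ∧ (p = 0 ∨ q < p)) : IsSimpleStrong D := by
  obtain ⟨f, hf⟩ := h
  refine ⟨fun v hv => hirr _ ((hf v v).mp hv), fun u w => ?_⟩
  have hn : 0 < n := (Nat.zero_le _).trans_lt (f u).2
  set r := f.symm ⟨0, hn⟩ with hr
  have hto : ∀ p, ∀ hp : p < n, Relation.ReflTransGen D.Adj (f.symm ⟨p, hp⟩) r := by
    intro p
    induction p using Nat.strong_induction_on with
    | _ p ih =>
      intro hp
      rcases Nat.eq_zero_or_pos p with rfl | hpos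
      · exact .refl
      · obtain ⟨q, hq, hpq⟩ := hout p hp hpos
        exact .head ((hf _ _).mpr (by simpa)) (ih q hq (hq.trans hp))
  have hfrom : ∀ d q, ∀ hq : q < n, n - q = d →
      Relation.ReflTransGen D.Adj r (f.symm ⟨q, hq⟩) := by
    intro d
    induction d using Nat.strong_induction_on with
    | _ d ih =>
      intro q hq hd
      rcases Nat.eq_zero_or_pos q with rfl | hpos
      · exact .refl
      · obtain ⟨p, hp, hpq, h0 | hlt⟩ := hin q hq hpos
        · subst h0
          exact .single ((hf _ _).mpr (by simpa [hr]))
        · exact .tail (ih (n - p) (by omega) p hp rfl) ((hf _ _).mpr (by simpa))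
  have h1 := hto (f u) (f u).2
  have h2 := hfrom _ (f w) (f w).2 rfl
  simp only [Fin.eta, Equiv.symm_apply_apply] at h1 h2
  exact h1.trans h2

theorem LabelledBy.isSimpleStrong_chord {V : Type*} {D : Digraph V} {n j : ℕ} (hn : 4 ≤ n)
    (hj : n - 3 ≤ j) (h : LabelledBy D n (ChordArc n j)) : IsSimpleStrong D := by
  refine h.isSimpleStrong (fun p hp => ?_)
    (fun p hp h0 => ⟨p - 1, by omega, by unfold ChordArc; omega⟩) fun q hq h0 => ?_
  · unfold ChordArc at hp; omega
  · rcases Nat.lt_or_ge (q + 1) n with h1 | h1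
    · exact ⟨q + 1, h1, by unfold ChordArc; omega⟩
    · exact ⟨0, by omega, by unfold ChordArc; omega⟩

theorem LabelledBy.isSimpleStrong_twin {V : Type*} {D : Digraph V} {n : ℕ} (hn : 4 ≤ n)
    (h : LabelledBy D n (TwinArc n)) : IsSimpleStrong D := by
  refine h.isSimpleStrong (fun p hp => ?_) (fun p hp h0 => ?_) fun q hq h0 => ?_
  · unfold TwinArc at hp; omega
  · rcases Nat.lt_or_ge p (n - 1) with h1 | h1
    · exact ⟨p - 1, by omega, by unfold TwinArc; omega⟩
    · exact ⟨n - 3, by omega, by unfold TwinArc; omega⟩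
  · rcases Nat.lt_or_ge (q + 2) n with h1 | h1
    · exact ⟨q + 1, by omega, by unfold TwinArc; omega⟩
    · exact ⟨0, by omega, by unfold TwinArc; omega⟩

theorem exists_labelledBy {V : Type*} [Fintype V] {n : ℕ} (hV : Fintype.card V = n)
    (R : ℕ → ℕ → Prop) : ∃ D : Digraph V, LabelledBy D n R :=
  ⟨⟨fun x y => R (Fintype.equivFinOfCardEq hV x) (Fintype.equivFinOfCardEq hV y)⟩, _,
    fun _ _ => Iff.rfl⟩

/-! ### The digraphs `θ(a, b, c)` as labelled models -/

/-- Arcs of a directed path, read off from an injective labelling whose values along the path are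
`φ 0, φ 1, …, φ (m + 1)`. -/
theorem pathArc_iff {W : Type*} {m : ℕ} {s t : W} {g : Fin m → W} {ℓ : W → ℕ}
    (hℓ : Function.Injective ℓ) (φ : ℕ → ℕ) (hs : ℓ s = φ 0) (ht : ℓ t = φ (m + 1))
    (hg : ∀ k : Fin m, ℓ (g k) = φ (k + 1)) (x y : W) :
    PathArc s g t x y ↔ ∃ i ≤ m, ℓ x = φ i ∧ ℓ y = φ (i + 1) := by
  have hφ : ∀ i : Fin (m + 2),
      ℓ ((Fin.cons s (Fin.snoc g t : Fin (m + 1) → W) : Fin (m + 2) → W) i) = φ i := by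
    intro i
    induction i using Fin.cases with
    | zero => simpa
    | succ i =>
      rw [Fin.cons_succ]
      induction i using Fin.lastCases with
      | last => simpa using ht
      | cast k => simpa using hg k
  constructor
  · rintro ⟨i, rfl, rfl⟩
    exact ⟨i, by omega, by rw [hφ]; simp, by rw [hφ]; simp⟩
  · rintro ⟨i, hi, hx, hy⟩
    refine ⟨⟨i, by omega⟩, hℓ ?_, hℓ ?_⟩
    · rw [hφ, hx]; simp
    · rw [hφ, hy]; simp

/-- A labelling of `θ(0, b, c)` by the distance to the source along its Hamiltonian cycle. -/
def chordLabel (b c : ℕ) : ThetaVertex 0 b c → ℕ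
  | .source => 0
  | .target => c + 1
  | .inA _ => 0
  | .inB k => c + 1 + b - k
  | .inC k => c - k

/-- A labelling of `θ(1, 1, c)` by the distance to the source, except that the second of the two
farthest vertices gets the next free label. -/
def twinLabel (c : ℕ) : ThetaVertex 1 1 c → ℕ
  | .source => 0
  | .target => c + 1
  | .inA _ => c + 2
  | .inB _ => c + 3
  | .inC k => c - k

theorem thetaDigraph_zero_labelledBy (b c : ℕ) (hb : 0 < b) :
    LabelledBy (thetaDigraph 0 b c) (b + c + 2) (ChordArc (b + c + 2) (c + 1)) := by
  have hinj : Function.Injective (chordLabel b c) := by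
    intro x y hxy
    rcases x with _ | _ | k | k | k <;> rcases y with _ | _ | l | l | l <;>
      simp only [chordLabel] at hxy <;>
      first
        | rfl
        | exact k.elim0
        | exact l.elim0
        | (congr 1; apply Fin.ext; omega)
        | (exfalso; omega)
  refine labelledBy_of_injective (chordLabel b c) (fun x => ?_) hinj (fun p hp => ?_) fun x y => ?_
  · rcases x with _ | _ | k | k | k <;> simp only [chordLabel] <;> omega
  · rcases Nat.eq_zero_or_pos p with rfl | h0
    · exact ⟨.source, rfl⟩
    rcases Nat.lt_or_ge p (c + 1) with h1 | h1
    · exact ⟨.inC ⟨c - p, by omega⟩, by simp only [chordLabel]; omega⟩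
    rcases h1.eq_or_lt with h2 | h2
    · exact ⟨.target, h2⟩
    · exact ⟨.inB ⟨c + 1 + b - p, by omega⟩, by simp only [chordLabel]; omega⟩
  · have hA := pathArc_iff (m := 0) (s := .source) (t := .target) (g := .inA) hinj
      (fun i => if i = 0 then 0 else c + 1) rfl rfl (fun k => k.elim0) x y
    have hB := pathArc_iff (s := .source) (t := .target) (g := .inB) hinj
      (fun i => if i = 0 then 0 else c + 2 + b - i) rfl (by simp [chordLabel]; omega)
      (fun k => by simp [chordLabel]; omega) x y
    have hC := pathArc_iff (s := .target) (t := .source) (g := .inC) hinj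
      (fun i => c + 1 - i) rfl (by simp [chordLabel]) (fun k => by simp [chordLabel]) x y
    change _ ∨ _ ∨ _ ↔ _
    rw [hA, hB, hC, ChordArc]
    clear hA hB hC
    have hx : chordLabel b c x < b + c + 2 := by
      rcases x with _ | _ | k | k | k <;> simp only [chordLabel] <;> omega
    generalize chordLabel b c x = p at *
    generalize chordLabel b c y = q at *
    constructor
    · rintro (⟨i, hi, h1, h2⟩ | ⟨i, hi, h1, h2⟩ | ⟨i, hi, h1, h2⟩)
      · split_ifs at h1 h2 <;> first | contradiction | omega
      · split_ifs at h1 h2 <;> first | contradiction | omega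
      · omega
    · rintro (h | ⟨h, h' | h'⟩)
      · rcases Nat.lt_or_ge p (c + 2) with h1 | h1
        · exact .inr (.inr ⟨c + 1 - p, by omega, by omega, by omega⟩)
        · refine .inr (.inl ⟨c + 2 + b - p, by omega, ?_, ?_⟩)
          · rw [if_neg (by omega)]; omega
          · rw [if_neg (by omega)]; omega
      · refine .inr (.inl ⟨0, by omega, by simpa, ?_⟩)
        rw [if_neg (by omega)]; omega
      · exact .inl ⟨0, by omega, by simpa, by simpa⟩

theorem thetaDigraph_one_one_labelledBy (c : ℕ) :
    LabelledBy (thetaDigraph 1 1 c) (c + 4) (TwinArc (c + 4)) := by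
  have hinj : Function.Injective (twinLabel c) := by
    intro x y hxy
    rcases x with _ | _ | k | k | k <;> rcases y with _ | _ | l | l | l <;>
      simp only [twinLabel] at hxy <;>
      first
        | rfl
        | (congr 1; apply Fin.ext; omega)
        | (exfalso; omega)
  refine labelledBy_of_injective (twinLabel c) (fun x => ?_) hinj (fun p hp => ?_) fun x y => ?_
  · rcases x with _ | _ | k | k | k <;> simp only [twinLabel] <;> omega
  · rcases Nat.eq_zero_or_pos p with rfl | h0
    · exact ⟨.source, rfl⟩
    rcases Nat.lt_or_ge p (c + 1) with h1 | h1
    · exact ⟨.inC ⟨c - p, by omega⟩, by simp only [twinLabel]; omega⟩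
    obtain rfl | rfl | rfl : p = c + 1 ∨ p = c + 2 ∨ p = c + 3 := by omega
    · exact ⟨.target, rfl⟩
    · exact ⟨.inA 0, rfl⟩
    · exact ⟨.inB 0, rfl⟩
  · have hA := pathArc_iff (m := 1) (s := .source) (t := .target) (g := .inA) hinj
      (fun i => if i = 0 then 0 else if i = 1 then c + 2 else c + 1) rfl rfl
      (fun k => by simp [twinLabel]) x y
    have hB := pathArc_iff (m := 1) (s := .source) (t := .target) (g := .inB) hinj
      (fun i => if i = 0 then 0 else if i = 1 then c + 3 else c + 1) rfl rfl
      (fun k => by simp [twinLabel]) x y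
    have hC := pathArc_iff (s := .target) (t := .source) (g := .inC) hinj
      (fun i => c + 1 - i) rfl (by simp [twinLabel]) (fun k => by simp [twinLabel]) x y
    change _ ∨ _ ∨ _ ↔ _
    rw [hA, hB, hC, TwinArc]
    clear hA hB hC
    generalize twinLabel c x = p at *
    generalize twinLabel c y = q at *
    constructor
    · rintro (⟨i, hi, h1, h2⟩ | ⟨i, hi, h1, h2⟩ | ⟨i, hi, h1, h2⟩)
      · split_ifs at h1 h2 <;> first | contradiction | omega
      · split_ifs at h1 h2 <;> first | contradiction | omega
      · omega
    · rintro (⟨h, h'⟩ | ⟨h, h'⟩ | ⟨h, h' | h'⟩)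
      · rcases Nat.lt_or_ge p (c + 2) with h1 | h1
        · exact .inr (.inr ⟨c + 1 - p, by omega, by omega, by omega⟩)
        · exact .inl ⟨1, le_rfl, by simp; omega, by simp; omega⟩
      · exact .inr (.inl ⟨1, le_rfl, by simp; omega, by simp; omega⟩)
      · exact .inl ⟨0, by omega, by simpa, by simp; omega⟩
      · exact .inr (.inl ⟨0, by omega, by simpa, by simp; omega⟩)

/-! ### Spectral radii of the models -/

theorem succSum_label {V : Type*} [Fintype V] {n : ℕ} (f : V ≃ Fin n) (R : ℕ → ℕ → Prop)
    [∀ p q, Decidable (R p q)] (g : ℕ → ℝ) (x : V) :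
    succSum ⟨fun x z => R (f x) (f z)⟩ (fun x => g (f x)) x =
      ∑ q ∈ range n with R (f x) q, g q := by
  classical
  rw [succSum_apply, Finset.sum_filter, Finset.sum_filter, ← Fin.sum_univ_eq_sum_range
    (fun q => if R (f x) q then g q else 0), ← Equiv.sum_comp f]
  exact Finset.sum_congr rfl fun z _ => by congr

theorem succSum_chord {V : Type*} [Fintype V] {n j : ℕ} (hj : j < n - 1) {t : ℝ} (ht : 0 < t)
    (h : t ^ n + t ^ (j + 1) = 1) (f : V ≃ Fin n) :
    succSum ⟨fun x z => ChordArc n j (f x) (f z)⟩ (fun x => t ^ (f x : ℕ)) =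
      t⁻¹ • fun x => t ^ (f x : ℕ) := by
  classical
  ext x
  rw [succSum_label f (ChordArc n j) (fun q => t ^ q)]
  simp only [Pi.smul_apply, smul_eq_mul]
  have hp := (f x).2
  generalize (f x : ℕ) = p at *
  rw [eq_inv_mul_iff_mul_eq₀ ht.ne']
  rcases p with _ | p
  · have : (range n).filter (ChordArc n j 0) = {n - 1, j} := by
      ext q; simp [ChordArc]; omega
    rw [this, Finset.sum_pair (by omega), mul_add, ← pow_succ', ← pow_succ', pow_zero,
      Nat.sub_add_cancel (by omega), h]
  · have : (range n).filter (ChordArc n j (p + 1)) = {p} := by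
      ext q; simp [ChordArc]; omega
    rw [this, Finset.sum_singleton, ← pow_succ']

theorem specRad_chord {V : Type*} [Fintype V] {D : Digraph V} {n j : ℕ} (hj : j < n - 1) {t : ℝ}
    (ht : 0 < t) (h : t ^ n + t ^ (j + 1) = 1) (hD : LabelledBy D n (ChordArc n j)) :
    specRad D = t⁻¹ := by
  obtain ⟨f, hf⟩ := hD
  obtain rfl : D = ⟨fun x z => ChordArc n j (f x) (f z)⟩ := by
    ext x y; exact hf x y
  have : Nonempty V := ⟨f.symm ⟨0, by omega⟩⟩
  exact specRad_eq (fun x => pow_pos ht _) (inv_nonneg.mpr ht.le) (succSum_chord hj ht h f)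

theorem specRad_twin {V : Type*} [Fintype V] {D : Digraph V} {n : ℕ} (hn : 4 ≤ n) {t : ℝ}
    (ht : 0 < t) (h : 2 * t ^ (n - 1) = 1) (hD : LabelledBy D n (TwinArc n)) :
    specRad D = t⁻¹ := by
  classical
  obtain ⟨f, hf⟩ := hD
  obtain rfl : D = ⟨fun x z => TwinArc n (f x) (f z)⟩ := by
    ext x y; exact hf x y
  have : Nonempty V := ⟨f.symm ⟨0, by omega⟩⟩
  -- The twins `n - 2` and `n - 1` have equal entries in the eigenvector.
  refine specRad_eq (y := fun x => t ^ (min (f x : ℕ) (n - 2))) (fun x => pow_pos ht _)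
    (inv_nonneg.mpr ht.le) ?_
  ext x
  rw [succSum_label f (TwinArc n) (fun q => t ^ (min q (n - 2)))]
  simp only [Pi.smul_apply, smul_eq_mul]
  have hp := (f x).2
  generalize (f x : ℕ) = p at *
  rw [eq_inv_mul_iff_mul_eq₀ ht.ne']
  rcases Nat.eq_zero_or_pos p with rfl | h0
  · have : (range n).filter (TwinArc n 0) = {n - 2, n - 1} := by
      ext q; simp [TwinArc]; omega
    rw [this, Finset.sum_pair (by omega), min_self, min_eq_right (by omega : n - 2 ≤ n - 1),
      ← two_mul, mul_left_comm, ← pow_succ', Nat.zero_min, pow_zero, ← h]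
    congr 2
    omega
  · have : (range n).filter (TwinArc n p) = {min p (n - 2) - 1} := by
      ext q; simp [TwinArc]; omega
    rw [this, Finset.sum_singleton, ← pow_succ']
    congr 1
    omega

/-- If every vertex has at most one out-neighbour, a strongly connected digraph is a directed
cycle; the constant vector is then an eigenvector. -/
theorem specRad_eq_one {V : Type*} [Fintype V] [Nontrivial V] {D : Digraph V}
    (hD : IsSimpleStrong D) (h : ∀ u v w, D.Adj u v → D.Adj u w → v = w) : specRad D = 1 := by
  classical
  refine specRad_eq (y := fun _ => 1) (by simp) zero_le_one ?_
  ext x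
  obtain ⟨w, hw⟩ := exists_ne x
  obtain hxw | ⟨z, hz, -⟩ := (hD.strong x w).cases_head
  · exact absurd hxw.symm hw
  have : univ.filter (D.Adj x) = {z} := by
    ext z'
    simpa using ⟨fun hz' => h _ _ _ hz' hz, fun e => e ▸ hz⟩
  simp only [succSum_apply, one_smul]
  rw [Finset.sum_const, this]
  simp

/-! ### Potentials and lower bounds for the spectral radius -/

theorem inv_eq_pow_add_pow {n : ℕ} {t : ℝ} (hn : 4 ≤ n) (h : t ^ n + t ^ (n - 2) = 1) :
    t⁻¹ = t ^ (n - 1) + t ^ (n - 3) := by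
  obtain ⟨m, rfl⟩ : ∃ m, n = m + 4 := ⟨n - 4, by omega⟩
  simp only [show m + 4 - 1 = m + 3 by omega, show m + 4 - 3 = m + 1 by omega,
    show m + 4 - 2 = m + 2 by omega] at *
  refine inv_eq_of_mul_eq_one_right ?_
  rw [← h]
  ring

theorem half_lt_of_pow_add_pow_eq_one {n : ℕ} {t : ℝ} (hn : 4 ≤ n) (ht : 0 < t)
    (h : t ^ n + t ^ (n - 2) = 1) : 1 / 2 < t := by
  by_contra! hle
  have h1 : t ^ n ≤ t ^ 2 := pow_le_pow_of_le_one ht.le (by linarith) (by omega)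
  have h2 : t ^ (n - 2) ≤ t ^ 2 := pow_le_pow_of_le_one ht.le (by linarith) (by omega)
  nlinarith

/-- A potential towards `u`: a function vanishing at `u` such that every other vertex has an
out-neighbour whose value is smaller by one. The distance to `u` is the basic example, but other
potentials need not be distances. -/
structure IsPotential {V : Type*} (D : Digraph V) (u : V) (h : V → ℕ) : Prop where
  root : h u = 0
  desc : ∀ x, x ≠ u → ∃ z, D.Adj x z ∧ h x = h z + 1

namespace IsPotential

variable {V : Type*} {D : Digraph V} {u : V} {h : V → ℕ} {n : ℕ} {t : ℝ}

theorem exists_value_eq (hp : IsPotential D u h) (x : V) {k : ℕ} (hk : k ≤ h x) :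
    ∃ z, h z = k := by
  induction hm : h x generalizing x with
  | zero => exact ⟨x, by omega⟩
  | succ m ih =>
    rcases hk.eq_or_lt with rfl | hlt
    · exact ⟨x, rfl⟩
    · obtain ⟨z, -, hz⟩ := hp.desc x (by rintro rfl; simp [hp.root] at hm)
      exact ih z (by omega) (by omega)

theorem value_lt_card [Fintype V] (hp : IsPotential D u h) (x : V) : h x < Fintype.card V := by
  classical
  have : range (h x + 1) ⊆ univ.image h := by
    intro k hk
    obtain ⟨z, hz⟩ := hp.exists_value_eq x (Nat.lt_succ_iff.mp (mem_range.mp hk))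
    exact mem_image.mpr ⟨z, mem_univ _, hz⟩
  have := (card_le_card this).trans card_image_le
  rw [card_range, card_univ] at this
  omega

/-- A potential from `u` is turned into one from a vertex `x`, alone at its level, by continuing
from `u` through an out-neighbour `v` of level `n - 2`. -/
theorem rotate (hp : IsPotential D u h) {v x : V} (huv : D.Adj u v) (hv : h v = n - 2)
    (hx0 : 1 ≤ h x) (hx : h x ≤ n - 2) (huniq : ∀ y, h y = h x → y = x) :
    IsPotential D x (fun y => if h x ≤ h y then h y - h x else h y + (n - 1 - h x)) where
  root := by simp
  desc y hy := by
    by_cases hyu : y = u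
    · subst hyu
      have := hp.root
      exact ⟨v, huv, by split_ifs <;> omega⟩
    · obtain ⟨z, hz, hyz⟩ := hp.desc y hyu
      have : h y ≠ h x := fun e => hy (huniq y e)
      exact ⟨z, hz, by split_ifs <;> omega⟩

/-- The test vector is `t ^ h`; the hypothesis on `v₁` and `v₂` makes it strict at `u`. -/
theorem lt_specRad [Fintype V] (hp : IsPotential D u h) (hD : IsSimpleStrong D) (ht : 0 < t)
    {v₁ v₂ : V} (h₁ : D.Adj u v₁) (h₂ : D.Adj u v₂) (hne : v₁ ≠ v₂)
    (hlt : t⁻¹ < t ^ h v₁ + t ^ h v₂) : t⁻¹ < specRad D := by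
  have hy : ∀ x, 0 < t ^ h x := fun x => pow_pos ht _
  have hu : t⁻¹ * t ^ h u < succSum D (fun x => t ^ h x) u := by
    rw [hp.root, pow_zero, mul_one]
    exact hlt.trans_le (add_le_succSum (fun x => (hy x).le) h₁ h₂ hne)
  refine _root_.lt_specRad hD (y := fun x => t ^ h x) hy (inv_nonneg.mpr ht.le) (fun x => ?_) hu
  by_cases hx : x = u
  · exact hx ▸ hu.le
  · obtain ⟨z, hz, hxz⟩ := hp.desc x hx
    simp only [Pi.smul_apply, smul_eq_mul]
    rw [hxz, pow_succ', inv_mul_cancel_left₀ ht.ne']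
    exact le_succSum (y := fun x => t ^ h x) (fun x => (hy x).le) hz

/-- Two out-neighbours of `u` that close up to cycles of lengths at most `n` and `n - 3`, or at most
`n - 1` and `n - 2`, make the spectral radius exceed that of `θ(0, 2, n - 4)`. -/
theorem lt_specRad_of_le [Fintype V] (hp : IsPotential D u h) (hD : IsSimpleStrong D) (hn : 4 ≤ n)
    (ht : 0 < t) (ht1 : t < 1) (h3 : t ^ n + t ^ (n - 2) = 1)
    {v₁ v₂ : V} (h₁ : D.Adj u v₁) (h₂ : D.Adj u v₂) (hne : v₁ ≠ v₂)
    (hle : h v₁ ≤ n - 1 ∧ h v₂ ≤ n - 4 ∨ h v₁ ≤ n - 2 ∧ h v₂ ≤ n - 3) : t⁻¹ < specRad D := by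
  refine hp.lt_specRad hD ht h₁ h₂ hne ?_
  rw [inv_eq_pow_add_pow hn h3]
  have hanti : ∀ {a b : ℕ}, a ≤ b → t ^ b ≤ t ^ a := pow_le_pow_of_le_one ht.le ht1.le
  rcases hle with ⟨ha, hb⟩ | ⟨ha, hb⟩
  · exact add_lt_add_of_le_of_lt (hanti ha)
      ((pow_lt_pow_right_of_lt_one₀ ht ht1 (by omega)).trans_le (hanti hb))
  · exact add_lt_add_of_lt_of_le
      ((pow_lt_pow_right_of_lt_one₀ ht ht1 (by omega)).trans_le (hanti ha)) (hanti hb)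

/-- Two out-neighbours of `u` at level `n - 2`, joined by an arc, also make the spectral radius
exceed that of `θ(0, 2, n - 4)`. -/
theorem lt_specRad_of_adj [Fintype V] (hp : IsPotential D u h) (hD : IsSimpleStrong D) (hn : 4 ≤ n)
    (ht : 0 < t) (h3 : t ^ n + t ^ (n - 2) = 1)
    {v₁ v₂ : V} (h₁ : D.Adj u v₁) (h₂ : D.Adj u v₂) (h₁₂ : D.Adj v₁ v₂)
    (hv₁ : h v₁ = n - 2) (hv₂ : h v₂ = n - 2) : t⁻¹ < specRad D := by
  classical
  have hne : v₁ ≠ v₂ := by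
    rintro rfl
    exact hD.loopless _ h₁₂
  have huv : u ≠ v₁ := by
    rintro rfl
    exact hD.loopless _ h₁
  -- The entry at `v₁` has room for the contribution of the additional arc `v₁ → v₂`.
  set y : V → ℝ := fun x => t ^ h x + if x = v₁ then t ^ (n - 1) else 0 with hydef
  have hle : ∀ x, t ^ h x ≤ y x := fun x => by
    simp only [hydef]
    split_ifs <;> simp [ht.le]
  have hy : ∀ x, 0 < y x := fun x => (pow_pos ht _).trans_le (hle x)
  have hy0 : 0 ≤ y := fun x => (hy x).le
  have hu : t⁻¹ * y u < succSum D y u := by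
    refine lt_of_lt_of_le ?_ (add_le_succSum hy0 h₁ h₂ hne)
    have e1 : y u = 1 := by simp [hydef, hp.root, huv]
    have e2 : y v₁ = t ^ (n - 2) + t ^ (n - 1) := by simp [hydef, hv₁]
    have e3 : y v₂ = t ^ (n - 2) := by simp [hydef, hv₂, hne.symm]
    rw [e1, e2, e3, mul_one, inv_eq_pow_add_pow hn h3]
    have e4 : t ^ (n - 2) = t * t ^ (n - 3) := by rw [← pow_succ']; congr 1; omega
    have := half_lt_of_pow_add_pow_eq_one hn ht h3
    have := pow_pos ht (n - 3)
    rw [e4]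
    nlinarith
  refine _root_.lt_specRad hD hy (inv_nonneg.mpr ht.le) (fun x => ?_) hu
  simp only [Pi.smul_apply, smul_eq_mul]
  by_cases hxu : x = u
  · exact hxu ▸ hu.le
  obtain ⟨z, hz, hxz⟩ := hp.desc x hxu
  rw [inv_mul_le_iff₀ ht]
  by_cases hx : x = v₁
  · subst hx
    have hne' : z ≠ v₂ := by
      rintro rfl
      omega
    have := add_le_succSum hy0 hz h₁₂ hne'
    have e1 : y x = t * t ^ h z + t * t ^ (n - 2) := by
      simp only [hydef, if_true]
      rw [← pow_succ', ← pow_succ', hxz, show n - 2 + 1 = n - 1 by omega]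
    rw [e1, ← mul_add]
    refine mul_le_mul_of_nonneg_left (le_trans ?_ this) ht.le
    exact add_le_add (hle z) (hv₂ ▸ hle v₂)
  · have e1 : y x = t * t ^ h z := by
      simp only [hydef, if_neg hx]
      rw [hxz, pow_succ', add_zero]
    rw [e1]
    exact mul_le_mul_of_nonneg_left ((hle z).trans (le_succSum hy0 hz)) ht.le

end IsPotential

/-- There is a walk with `k` arcs from the vertex to `u`. -/
def ReachesIn {V : Type*} (D : Digraph V) (u : V) : ℕ → V → Prop
  | 0, x => x = u
  | k + 1, x => ∃ z, D.Adj x z ∧ ReachesIn D u k z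

/-- The distance to a fixed vertex. -/
theorem IsSimpleStrong.exists_dist {V : Type*} {D : Digraph V} (hD : IsSimpleStrong D) (u : V) :
    ∃ h : V → ℕ, IsPotential D u h ∧ ∀ x z, D.Adj x z → h x ≤ h z + 1 := by
  have hne : ∀ x, {k | ReachesIn D u k x}.Nonempty := by
    intro x
    induction hD.strong x u using Relation.ReflTransGen.head_induction_on with
    | refl => exact ⟨0, rfl⟩
    | head hab _ ih =>
      obtain ⟨k, hk⟩ := ih
      exact ⟨k + 1, _, hab, hk⟩
  have hle : ∀ x z, D.Adj x z → sInf {k | ReachesIn D u k x} ≤ sInf {k | ReachesIn D u k z} + 1 :=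
    fun x z hz => Nat.sInf_le ⟨z, hz, Nat.sInf_mem (hne z)⟩
  refine ⟨fun x => sInf {k | ReachesIn D u k x}, ⟨Nat.sInf_eq_zero.mpr (.inl rfl), ?_⟩, hle⟩
  intro x hx
  have hmem := Nat.sInf_mem (hne x)
  cases hk : sInf {k | ReachesIn D u k x} with
  | zero => rw [hk] at hmem; exact absurd hmem hx
  | succ k =>
    rw [hk] at hmem
    obtain ⟨z, hz, hkz⟩ := hmem
    have h1 := hle x z hz
    have h2 : sInf {k | ReachesIn D u k z} ≤ k := Nat.sInf_le hkz
    exact ⟨z, hz, by omega⟩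

/-! ### Classification of the small spectral radii -/

section Classification

variable {V : Type*} [Fintype V] {D : Digraph V} {n : ℕ} {t : ℝ} {u : V} {h : V → ℕ}

/-- Two out-neighbours at levels `n - 1` and `n - 3`. -/
theorem chord_three_or_lt (hV : Fintype.card V = n) (hn : 4 ≤ n) (hD : IsSimpleStrong D)
    (ht : 0 < t) (h3 : t ^ n + t ^ (n - 2) = 1) (hp : IsPotential D u h)
    (hsurj : ∀ p < n, ∃ x, h x = p) (hinj : Function.Injective h)
    {v₁ v₂ : V} (h₁ : D.Adj u v₁) (h₂ : D.Adj u v₂) (hv₁ : h v₁ = n - 1) (hv₂ : h v₂ = n - 3) :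
    LabelledBy D n (ChordArc n (n - 3)) ∨ t⁻¹ < specRad D := by
  have hlt : ∀ x, h x < n := fun x => hV ▸ hp.value_lt_card x
  have hsub : ∀ x z, ChordArc n (n - 3) (h x) (h z) → D.Adj x z := by
    rintro x z (hxz | ⟨hx, hz | hz⟩)
    · obtain ⟨z', hz', e⟩ := hp.desc x (by rintro rfl; simp [hp.root] at hxz)
      obtain rfl : z' = z := hinj (by omega)
      exact hz'
    · obtain rfl : x = u := hinj (by rw [hx, hp.root])
      obtain rfl : z = v₁ := hinj (by omega)
      exact h₁
    · obtain rfl : x = u := hinj (by rw [hx, hp.root])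
      obtain rfl : z = v₂ := hinj (by omega)
      exact h₂
  by_cases hall : ∀ x z, D.Adj x z → ChordArc n (n - 3) (h x) (h z)
  · exact .inl (labelledBy_of_injective h hlt hinj hsurj fun x z => ⟨hall x z, hsub x z⟩)
  · push Not at hall
    obtain ⟨x, z, hxz, hnot⟩ := hall
    let f : V ≃ Fin n := Equiv.ofBijective (fun x => ⟨h x, hlt x⟩)
      ⟨fun x y hxy => hinj (by simpa using hxy), fun p => by
        obtain ⟨x, hx⟩ := hsurj p p.2
        exact ⟨x, Fin.ext hx⟩⟩
    refine .inr (lt_specRad_of_lt hD (R := fun x z => ChordArc n (n - 3) (f x) (f z)) hsub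
      (fun x => pow_pos ht _) (inv_nonneg.mpr ht.le)
      (succSum_chord (by omega) ht ?_ f) hxz hnot)
    rwa [show n - 3 + 1 = n - 2 by omega]

/-- Two out-neighbours at levels `n - 1` and `n - 2`. -/
theorem chord_two_or_lt (hV : Fintype.card V = n) (hn : 4 ≤ n) (hD : IsSimpleStrong D)
    (ht : 0 < t) (ht1 : t < 1) (h3 : t ^ n + t ^ (n - 2) = 1) (hp : IsPotential D u h)
    (hadj : ∀ x z, D.Adj x z → h x ≤ h z + 1)
    (hsurj : ∀ p < n, ∃ x, h x = p) (hinj : Function.Injective h)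
    {v₁ v₂ : V} (h₁ : D.Adj u v₁) (h₂ : D.Adj u v₂) (hv₁ : h v₁ = n - 1) (hv₂ : h v₂ = n - 2) :
    LabelledBy D n (ChordArc n (n - 2)) ∨ LabelledBy D n (ChordArc n (n - 3)) ∨
      t⁻¹ < specRad D := by
  have hlt : ∀ x, h x < n := fun x => hV ▸ hp.value_lt_card x
  by_cases hall : ∀ x z, D.Adj x z → ChordArc n (n - 2) (h x) (h z)
  · refine .inl (labelledBy_of_injective h hlt hinj hsurj fun x z => ⟨hall x z, ?_⟩)
    rintro (hxz | ⟨hx, hz | hz⟩)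
    · obtain ⟨z', hz', e⟩ := hp.desc x (by rintro rfl; simp [hp.root] at hxz)
      obtain rfl : z' = z := hinj (by omega)
      exact hz'
    · obtain rfl : x = u := hinj (by rw [hx, hp.root])
      obtain rfl : z = v₁ := hinj (by omega)
      exact h₁
    · obtain rfl : x = u := hinj (by rw [hx, hp.root])
      obtain rfl : z = v₂ := hinj (by omega)
      exact h₂
  right
  push Not at hall
  obtain ⟨x, z, hxz, hnot⟩ := hall
  unfold ChordArc at hnot
  have hle := hadj x z hxz
  have hzn := hlt z
  have hne : h x ≠ h z := fun e => hD.loopless x (by rwa [← hinj e] at hxz)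
  rcases Nat.eq_zero_or_pos (h x) with hx | hx
  · obtain rfl : x = u := hinj (by rw [hx, hp.root])
    have hzv : v₁ ≠ z := by rintro rfl; omega
    by_cases hz3 : h z = n - 3
    · exact chord_three_or_lt hV hn hD ht h3 hp hsurj hinj h₁ hxz hv₁ hz3
    · exact .inr (hp.lt_specRad_of_le hD hn ht ht1 h3 h₁ hxz hzv (.inl (by omega)))
  · right
    have hp' := hp.rotate (x := x) h₂ hv₂ hx (by omega) fun y hy => hinj hy
    obtain ⟨w, hw, hxw⟩ := hp.desc x (by rintro rfl; simp [hp.root] at hx)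
    by_cases hlast : h x = 1 ∧ h z = n - 1
    · obtain ⟨hx1, hz1⟩ := hlast
      obtain rfl : w = u := hinj (by rw [hp.root]; omega)
      obtain rfl : z = v₁ := hinj (by omega)
      have := hp.root
      exact hp'.lt_specRad_of_adj hD hn ht h3 hw hxz h₁ (by split_ifs <;> omega)
        (by split_ifs <;> omega)
    · refine hp'.lt_specRad_of_le hD hn ht ht1 h3 hw hxz (by rintro rfl; omega) (.inr ⟨?_, ?_⟩)
      · split_ifs <;> omega
      · split_ifs <;> omega

/-- Two out-neighbours at level `n - 2`. -/
theorem twin_or_lt (hn : 4 ≤ n) (hD : IsSimpleStrong D)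
    (ht : 0 < t) (ht1 : t < 1) (h3 : t ^ n + t ^ (n - 2) = 1) (hp : IsPotential D u h)
    (hadj : ∀ x z, D.Adj x z → h x ≤ h z + 1) (hlt : ∀ x, h x ≤ n - 2)
    {v₁ v₂ : V} (h₁ : D.Adj u v₁) (h₂ : D.Adj u v₂) (hne : v₁ ≠ v₂)
    (hv₁ : h v₁ = n - 2) (hv₂ : h v₂ = n - 2)
    (hinj : ∀ x y, x ≠ v₁ → y ≠ v₁ → h x = h y → x = y) :
    LabelledBy D n (TwinArc n) ∨ t⁻¹ < specRad D := by
  classical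
  have htop : ∀ x, h x = n - 2 → x = v₁ ∨ x = v₂ := by
    intro x hx
    by_cases hxv : x = v₁
    · exact .inl hxv
    · exact .inr (hinj x v₂ hxv hne.symm (by omega))
  have hinj' : ∀ x y, h x ≠ n - 2 → h x = h y → x = y := by
    intro x y hx hxy
    exact hinj x y (by rintro rfl; omega) (by rintro rfl; omega) hxy
  have hroot := hp.root
  set f : V → ℕ := fun x => if x = v₁ then n - 1 else h x with hf
  have hf₁ : f v₁ = n - 1 := by simp [hf]
  have hf' : ∀ x, x ≠ v₁ → f x = h x := fun x hx => by simp [hf, hx]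
  have hfinj : Function.Injective f := by
    intro x y hxy
    by_cases hx : x = v₁ <;> by_cases hy : y = v₁
    · rw [hx, hy]
    · have := hlt y; rw [hx, hf₁, hf' y hy] at hxy; omega
    · have := hlt x; rw [hy, hf₁, hf' x hx] at hxy; omega
    · exact hinj x y hx hy (by rwa [hf' x hx, hf' y hy] at hxy)
  have hfsurj : ∀ p < n, ∃ x, f x = p := by
    intro p hpn
    by_cases hp1 : p = n - 1
    · exact ⟨v₁, hp1 ▸ hf₁⟩
    by_cases hp2 : p = n - 2
    · exact ⟨v₂, by rw [hf' _ hne.symm, hv₂, hp2]⟩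
    obtain ⟨x, hx⟩ := hp.exists_value_eq v₁ (k := p) (by omega)
    exact ⟨x, by rw [hf' x (by rintro rfl; omega), hx]⟩
  by_cases hall : ∀ x z, D.Adj x z → h x = h z + 1 ∨ x = u ∧ (z = v₁ ∨ z = v₂)
  · left
    have hfv₂ : f v₂ = n - 2 := by rw [hf' _ hne.symm, hv₂]
    have hu₁ : u ≠ v₁ := by rintro rfl; omega
    have hfu : f u = 0 := by rw [hf' _ hu₁, hroot]
    refine labelledBy_of_injective f (fun x => ?_) hfinj hfsurj fun x z => ⟨fun hxz => ?_, ?_⟩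
    · have := hlt x
      simp only [hf]
      split_ifs <;> omega
    · have hx := hlt x
      rcases hall x z hxz with e | ⟨rfl, rfl | rfl⟩
      · have hz : f z = h z := hf' z (by rintro rfl; omega)
        rw [TwinArc, hz]
        by_cases hxv : x = v₁
        · rw [hxv, hf₁]
          rw [hxv] at e
          omega
        · rw [hf' x hxv]
          omega
      · rw [TwinArc]; omega
      · rw [TwinArc]; omega
    · -- Below the twins each level has one vertex, so every vertex but `u` points to all of the
      -- level just below it.
      have hdesc : ∀ x z, f x ≠ 0 → z ≠ v₁ → h z ≠ n - 2 → h x = h z + 1 → D.Adj x z := by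
        intro x z hx hz hz' e
        obtain ⟨z', hxz', e'⟩ := hp.desc x (by rintro rfl; exact hx hfu)
        rwa [hinj' z z' hz' (by omega)]
      rintro (⟨e, hle⟩ | ⟨hx, hz⟩ | ⟨hx, hz | hz⟩)
      · have hzv : z ≠ v₁ := by rintro rfl; omega
        have hxv : x ≠ v₁ := by rintro rfl; omega
        have e1 := hf' x hxv
        have e2 := hf' z hzv
        exact hdesc x z (by omega) hzv (by omega) (by omega)
      · obtain rfl : x = v₁ := hfinj (by omega)
        have hzv : z ≠ x := by rintro rfl; omega
        have e2 := hf' z hzv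
        exact hdesc x z (by omega) hzv (by omega) (by omega)
      · obtain rfl : x = u := hfinj (by omega)
        obtain rfl : z = v₂ := hfinj (by omega)
        exact h₂
      · obtain rfl : x = u := hfinj (by omega)
        obtain rfl : z = v₁ := hfinj (by omega)
        exact h₁
  right
  push Not at hall
  obtain ⟨x, z, hxz, hnot, hnot'⟩ := hall
  have hle := hadj x z hxz
  have hxn := hlt x
  have hzn := hlt z
  have hxz' : x ≠ z := fun e => hD.loopless x (by rwa [← e] at hxz)
  rcases Nat.eq_zero_or_pos (h x) with hx | hx
  · obtain rfl : x = u := hinj' x u (by omega) (by rw [hx, hroot])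
    obtain ⟨hz₁, hz₂⟩ := hnot' rfl
    have : h z ≠ n - 2 := fun e => (htop z e).elim hz₁ hz₂
    exact hp.lt_specRad_of_le hD hn ht ht1 h3 h₁ hxz hz₁.symm (.inr (by omega))
  by_cases hx2 : h x = n - 2
  · rcases htop x hx2 with rfl | rfl <;> rcases htop z (by omega) with rfl | rfl
    · exact absurd rfl hxz'
    · exact hp.lt_specRad_of_adj hD hn ht h3 h₁ h₂ hxz hv₁ hv₂
    · exact hp.lt_specRad_of_adj hD hn ht h3 h₂ h₁ hxz hv₂ hv₁
    · exact absurd rfl hxz'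
  · have hne' : h x ≠ h z := fun e => hxz' (hinj' x z hx2 e)
    have hp' := hp.rotate (x := x) h₁ hv₁ hx (by omega) fun y hy => (hinj' x y hx2 hy.symm).symm
    obtain ⟨w, hw, hxw⟩ := hp.desc x (by rintro rfl; omega)
    refine hp'.lt_specRad_of_le hD hn ht ht1 h3 hw hxz (by rintro rfl; omega) (.inr ⟨?_, ?_⟩)
    · split_ifs <;> omega
    · split_ifs <;> omega

/-- A strongly connected digraph is a cycle, or one of the three extremal digraphs, or its spectral
radius exceeds `t⁻¹`, the spectral radius of `θ(0, 2, n - 4)`. -/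
theorem specRad_classification (hV : Fintype.card V = n) (hn : 4 ≤ n) (hD : IsSimpleStrong D)
    (ht : 0 < t) (ht1 : t < 1) (h3 : t ^ n + t ^ (n - 2) = 1) :
    specRad D = 1 ∨ LabelledBy D n (ChordArc n (n - 2)) ∨ LabelledBy D n (TwinArc n) ∨
      LabelledBy D n (ChordArc n (n - 3)) ∨ t⁻¹ < specRad D := by
  by_cases hfun : ∀ u v w, D.Adj u v → D.Adj u w → v = w
  · have : Nontrivial V := Fintype.one_lt_card_iff_nontrivial.mp (by omega)
    exact .inl (specRad_eq_one hD hfun)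
  right
  push Not at hfun
  obtain ⟨u, v, w, hv, hw, hvw⟩ := hfun
  obtain ⟨h, hp, hadj⟩ := hD.exists_dist u
  obtain ⟨v₁, v₂, h₁, h₂, hne, hle⟩ :
      ∃ v₁ v₂, D.Adj u v₁ ∧ D.Adj u v₂ ∧ v₁ ≠ v₂ ∧ h v₂ ≤ h v₁ := by
    rcases le_total (h v) (h w) with hle | hle
    · exact ⟨w, v, hw, hv, hvw.symm, hle⟩
    · exact ⟨v, w, hv, hw, hvw, hle⟩
  have hlt : ∀ x, h x < n := fun x => hV ▸ hp.value_lt_card x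
  have hbij : ∀ f : V → Fin n, Function.Surjective f → Function.Injective f := fun f hf =>
    ((Fintype.bijective_iff_surjective_and_card f).mpr ⟨hf, by simpa⟩).1
  have htop : ∀ x, h x = n - 1 → (∀ p < n, ∃ x, h x = p) ∧ Function.Injective h := by
    intro x hx
    have hsurj : ∀ p < n, ∃ x, h x = p := fun p hpn => hp.exists_value_eq x (by omega)
    refine ⟨hsurj, fun y z hyz => hbij (fun x => ⟨h x, hlt x⟩) (fun p => ?_) (Fin.ext hyz)⟩
    obtain ⟨y, hy⟩ := hsurj p p.2
    exact ⟨y, Fin.ext hy⟩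
  have hlt₁ := hlt v₁
  by_cases hv₁ : h v₁ = n - 1
  · obtain ⟨hsurj, hinj⟩ := htop v₁ hv₁
    have hne' : h v₁ ≠ h v₂ := fun e => hne (hinj e)
    by_cases hv₂ : h v₂ = n - 2
    · rcases chord_two_or_lt hV hn hD ht ht1 h3 hp hadj hsurj hinj h₁ h₂ hv₁ hv₂ with e | e | e
      · exact .inl e
      · exact .inr (.inr (.inl e))
      · exact .inr (.inr (.inr e))
    by_cases hv₃ : h v₂ = n - 3
    · exact .inr (.inr (chord_three_or_lt hV hn hD ht h3 hp hsurj hinj h₁ h₂ hv₁ hv₃))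
    · exact .inr (.inr (.inr
        (hp.lt_specRad_of_le hD hn ht ht1 h3 h₁ h₂ hne (.inl (by omega)))))
  by_cases hv₂ : h v₂ = n - 2
  · have hv₁' : h v₁ = n - 2 := by omega
    have hle2 : ∀ x, h x ≤ n - 2 := by
      intro x
      by_contra! hx
      exact hne ((htop x (by have := hlt x; omega)).2 (by omega))
    have hinj : ∀ x y, x ≠ v₁ → y ≠ v₁ → h x = h y → x = y := by
      classical
      intro x y hx hy hxy
      refine hbij (fun x => if x = v₁ then ⟨n - 1, by omega⟩ else ⟨h x, hlt x⟩) (fun p => ?_)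
        (by simp [hx, hy, hxy])
      by_cases hp1 : (p : ℕ) = n - 1
      · exact ⟨v₁, by simp [Fin.ext_iff, hp1]⟩
      by_cases hp2 : (p : ℕ) = n - 2
      · exact ⟨v₂, by simp [Fin.ext_iff, hp2, hne.symm, hv₂]⟩
      obtain ⟨z, hz⟩ := hp.exists_value_eq v₁ (k := p) (by omega)
      refine ⟨z, ?_⟩
      have : z ≠ v₁ := by rintro rfl; omega
      simp [this, hz]
    rcases twin_or_lt hn hD ht ht1 h3 hp hadj hle2 h₁ h₂ hne hv₁' hv₂ hinj with e | e
    · exact .inr (.inl e)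
    · exact .inr (.inr (.inr e))
  · exact .inr (.inr (.inr
      (hp.lt_specRad_of_le hD hn ht ht1 h3 h₁ h₂ hne (.inr (by omega)))))

end Classification

/-! ### The ranking -/

theorem exists_pow_add_pow_eq_one {a b : ℕ} (ha : 0 < a) (hb : 0 < b) :
    ∃ t : ℝ, 0 < t ∧ t < 1 ∧ t ^ a + t ^ b = 1 := by
  have hcont : ContinuousOn (fun t : ℝ => t ^ a + t ^ b) (Set.Icc 0 1) := by fun_prop
  obtain ⟨t, ht, h⟩ := intermediate_value_Ioo zero_le_one hcont
    (show (1 : ℝ) ∈ _ by simp [ha.ne', hb.ne'])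
  exact ⟨t, ht.1, ht.2, h⟩

/-- If the values in `S` are exactly `a 0 < a 1 < a 2 < a 3` and some values larger than `a 3`, then
`a k` is the only value of `S` with exactly `k` smaller ones, for `k < 4`. -/
theorem encard_lt_eq_iff {S : Set ℝ} {a : ℕ → ℝ} (ha : StrictMonoOn a (Set.Iio 4))
    (hmem : ∀ k < 4, a k ∈ S) (hS : ∀ r ∈ S, (∃ k < 4, r = a k) ∨ a 3 < r) {k : ℕ} (hk : k < 4)
    {r : ℝ} (hr : r ∈ S) : {s | s < r ∧ s ∈ S}.encard = k ↔ r = a k := by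
  have hcard : ∀ m ≤ 4, (a '' Set.Iio m).encard = m := by
    intro m hm
    rw [(ha.injOn.mono (Set.Iio_subset_Iio hm)).encard_image, ← Finset.coe_Iio,
      Set.encard_coe_eq_coe_finsetCard]
    simp
  have hset : ∀ m < 4, {s | s < a m ∧ s ∈ S} = a '' Set.Iio m := by
    intro m hm
    ext s
    constructor
    · rintro ⟨hs, hsS⟩
      rcases hS s hsS with ⟨l, hl, rfl⟩ | hs3
      · exact ⟨l, (ha.lt_iff_lt hl hm).mp hs, rfl⟩
      · have : a m ≤ a 3 := ha.monotoneOn hm (by simp) (by omega)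
        linarith
    · rintro ⟨l, hl, rfl⟩
      have hl4 : l < 4 := lt_trans hl hm
      exact ⟨ha hl4 hm hl, hmem l hl4⟩
  constructor
  · intro h
    rcases hS r hr with ⟨m, hm, rfl⟩ | h3
    · rw [hset m hm, hcard m hm.le] at h
      rw [Nat.cast_injective h]
    · have hsub : a '' Set.Iio 4 ⊆ {s | s < r ∧ s ∈ S} := by
        rintro _ ⟨l, hl, rfl⟩
        have : a l ≤ a 3 := ha.monotoneOn hl (by simp) (by have : l < 4 := hl; omega)
        exact ⟨this.trans_lt h3, hmem l hl⟩
      have := Set.encard_le_encard hsub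
      rw [h, hcard 4 le_rfl] at this
      have : 4 ≤ k := by exact_mod_cast this
      omega
  · rintro rfl
    rw [hset k hk, hcard k hk.le]

theorem theorem7p3 (n : ℕ) (hn : 4 ≤ n) {V : Type*} [Fintype V] (hV : Fintype.card V = n)
    (D : Digraph V) :
    (AchievesKthSmallest 2 D ↔ Nonempty (D.Adj ≃r (thetaDigraph 0 1 (n - 3)).Adj)) ∧
    (AchievesKthSmallest 3 D ↔ Nonempty (D.Adj ≃r (thetaDigraph 1 1 (n - 4)).Adj)) ∧
    (AchievesKthSmallest 4 D ↔ Nonempty (D.Adj ≃r (thetaDigraph 0 2 (n - 4)).Adj)) := by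
  have hθ₁ := thetaDigraph_zero_labelledBy 1 (n - 3) one_pos
  have hθ₂ := thetaDigraph_one_one_labelledBy (n - 4)
  have hθ₃ := thetaDigraph_zero_labelledBy 2 (n - 4) two_pos
  rw [show 1 + (n - 3) + 2 = n by omega, show n - 3 + 1 = n - 2 by omega] at hθ₁
  rw [show n - 4 + 4 = n by omega] at hθ₂
  rw [show 2 + (n - 4) + 2 = n by omega, show n - 4 + 1 = n - 3 by omega] at hθ₃
  rw [hθ₁.nonempty_relIso_iff, hθ₂.nonempty_relIso_iff, hθ₃.nonempty_relIso_iff]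
  -- The reciprocals of the three spectral radii.
  obtain ⟨t₁, ht₁, ht₁', e₁⟩ := exists_pow_add_pow_eq_one (a := n) (b := n - 1) (by omega) (by omega)
  obtain ⟨t₂, ht₂, ht₂', e₂⟩ :=
    exists_pow_add_pow_eq_one (a := n - 1) (b := n - 1) (by omega) (by omega)
  obtain ⟨t₃, ht₃, ht₃', e₃⟩ := exists_pow_add_pow_eq_one (a := n) (b := n - 2) (by omega) (by omega)
  have h21 : t₂ < t₁ := by
    by_contra! hle
    have h1 : t₁ ^ (n - 1) ≤ t₂ ^ (n - 1) := by gcongr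
    have h2 : t₁ ^ n < t₁ ^ (n - 1) := pow_lt_pow_right_of_lt_one₀ ht₁ ht₁' (by omega)
    linarith
  have h32 : t₃ < t₂ := by
    by_contra! hle
    have h1 : t₂ ^ n ≤ t₃ ^ n := by gcongr
    have h2 : t₂ ^ (n - 2) ≤ t₃ ^ (n - 2) := by gcongr
    have h3 : 2 * t₂ ^ (n - 1) < t₂ ^ n + t₂ ^ (n - 2) := by
      obtain ⟨m, rfl⟩ : ∃ m, n = m + 2 := ⟨n - 2, by omega⟩
      simp only [Nat.add_sub_cancel, show m + 2 - 1 = m + 1 by omega]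
      have := mul_pos (pow_pos ht₂ m) (pow_pos (sub_pos.mpr ht₂') 2)
      linear_combination this
    linarith
  have r₁ : ∀ {D : Digraph V}, LabelledBy D n (ChordArc n (n - 2)) → specRad D = t₁⁻¹ :=
    specRad_chord (by omega) ht₁ (by rwa [show n - 2 + 1 = n - 1 by omega])
  have r₂ : ∀ {D : Digraph V}, LabelledBy D n (TwinArc n) → specRad D = t₂⁻¹ :=
    specRad_twin hn ht₂ (by rwa [two_mul])
  have r₃ : ∀ {D : Digraph V}, LabelledBy D n (ChordArc n (n - 3)) → specRad D = t₃⁻¹ :=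
    specRad_chord (by omega) ht₃ (by rwa [show n - 3 + 1 = n - 2 by omega])
  have i₁ : 1 < t₁⁻¹ := (one_lt_inv₀ ht₁).mpr ht₁'
  have i₂ : t₁⁻¹ < t₂⁻¹ := (inv_lt_inv₀ ht₁ ht₂).mpr h21
  have i₃ : t₂⁻¹ < t₃⁻¹ := (inv_lt_inv₀ ht₂ ht₃).mpr h32
  set S : Set ℝ := {r | ∃ D' : Digraph V, IsSimpleStrong D' ∧ specRad D' = r}
  let a : ℕ → ℝ
    | 0 => 1
    | 1 => t₁⁻¹
    | 2 => t₂⁻¹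
    | _ => t₃⁻¹
  have ha : StrictMonoOn a (Set.Iio 4) := by
    intro k hk l hl hkl
    have hk : k < 4 := hk
    have hl : l < 4 := hl
    interval_cases l <;> interval_cases k <;> simp only [a] <;> linarith
  have hmem : ∀ k < 4, a k ∈ S := by
    intro k hk
    interval_cases k
    · obtain ⟨D, hD⟩ := exists_labelledBy hV (ChordArc n (n - 1))
      have hs := hD.isSimpleStrong_chord hn (by omega)
      have : Nontrivial V := Fintype.one_lt_card_iff_nontrivial.mp (by omega)
      refine ⟨D, hs, specRad_eq_one hs ?_⟩
      obtain ⟨f, hf⟩ := hD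
      intro u v w hv hw
      rw [hf, ChordArc] at hv hw
      exact f.injective (Fin.ext (by omega))
    · obtain ⟨D, hD⟩ := exists_labelledBy hV (ChordArc n (n - 2))
      exact ⟨D, hD.isSimpleStrong_chord hn (by omega), r₁ hD⟩
    · obtain ⟨D, hD⟩ := exists_labelledBy hV (TwinArc n)
      exact ⟨D, hD.isSimpleStrong_twin hn, r₂ hD⟩
    · obtain ⟨D, hD⟩ := exists_labelledBy hV (ChordArc n (n - 3))
      exact ⟨D, hD.isSimpleStrong_chord hn (by omega), r₃ hD⟩
  have hall : ∀ r ∈ S, (∃ k < 4, r = a k) ∨ a 3 < r := by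
    rintro r ⟨D', hD', rfl⟩
    rcases specRad_classification hV hn hD' ht₃ ht₃' e₃ with h | h | h | h | h
    · exact .inl ⟨0, by omega, h⟩
    · exact .inl ⟨1, by omega, r₁ h⟩
    · exact .inl ⟨2, by omega, r₂ h⟩
    · exact .inl ⟨3, by omega, r₃ h⟩
    · exact .inr h
  have hach : ∀ k < 4, AchievesKthSmallest (k + 1) D ↔ IsSimpleStrong D ∧ specRad D = a k := by
    intro k hk
    refine and_congr_right fun hD => ?_
    rw [← encard_lt_eq_iff ha hmem hall hk ⟨D, hD, rfl⟩, Nat.cast_add, Nat.cast_one]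
    exact (ENat.add_left_injective_of_ne_top ENat.one_ne_top).eq_iff
  rw [hach 1 (by omega), hach 2 (by omega), hach 3 (by omega)]
  refine ⟨⟨fun ⟨hD, h⟩ => ?_, fun h => ⟨h.isSimpleStrong_chord hn (by omega), r₁ h⟩⟩,
    ⟨fun ⟨hD, h⟩ => ?_, fun h => ⟨h.isSimpleStrong_twin hn, r₂ h⟩⟩,
    ⟨fun ⟨hD, h⟩ => ?_, fun h => ⟨h.isSimpleStrong_chord hn (by omega), r₃ h⟩⟩⟩ <;>
  · simp only [a] at h
    rcases specRad_classification hV hn hD ht₃ ht₃' e₃ with h' | h' | h' | h' | h' <;>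
      first
        | exact h'
        | (exfalso; linarith)
        | (exfalso; have := r₁ h'; linarith)
        | (exfalso; have := r₂ h'; linarith)
        | (exfalso; have := r₃ h'; linarith)
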